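/- **Conventions.** An *event structure* $(E,\le,\mathrm{Con})$ is a set $E$ with a partial order $\le$ in which every $\{e'\mid e'\le e\}$ is finite, and a nonempty family $\mathrm{Con}$ of finite subsets of $E$ that contains all singletons, is closed under subsets, and satisfies: $X\in\mathrm{Con}$ and $e\le e'\in X$ imply $X\cup\{e\}\in\mathrm{Con}$. A *configuration* is a (possibly infinite) down-closed set of events all of whose finite subsets are in $\mathrm{Con}$. Write $e\to e'$ if $e\neq e'$, $e\le e'$ and no event lies strictly between them. A *total map* is a function on events that sends configurations to configurations and is injective on each configuration. Events may carry polarities $+$ (Player), $-$ (Opponent), $0$ (neutral), preserved by maps between event structures with polarity; $x\subseteq^- y$ means that $x\subseteq y$ and all events of $y\setminus x$ have polarity $-$, and $x\subseteq^+ y$ that $x\subseteq y$ and all events of $y\setminus x$ have polarity $+$ or $0$. A configuration is *$+$-maximal* if it is maximal among configurations with respect to $\subseteq^+$. A *game* has no neutral events; $A^\perp$ is $A$ with $+$ and $-$ exchanged, and $\parallel$ is juxtaposition, with no causal dependency or conflict across components. $A$ is *race-free* if, for configurations, $x\subseteq^+y$ and $x\subseteq^-z$ imply that $y\cup z$ is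 a configuration. $A$ is *consistent-countable* if there is $\chi:A\to\mathbb N$ such that $\{a,a'\}\in\mathrm{Con}$ and $\chi(a)=\chi(a')$ imply $a=a'$. A *strategy in a game $A$* is a total, polarity-preserving map $\sigma:S\to A$ which is *receptive* (if $x$ and $y$ are finite configurations of $S$ and $A$ with $\sigma x\subseteq^- y$, there is a unique finite configuration $x'\supseteq x$ of $S$ with $\sigma x'=y$) and *innocent* ($s\to s'$ implies $\sigma(s)\to\sigma(s')$ whenever $s$ has polarity $+$ or $s'$ has polarity $-$). A *stopping strategy in $A$* is a pair $(\sigma,M)$ of a strategy $\sigma:S\to A$ and any set $M$ of configurations of $S$, its *stopping configurations*. A *test* for $A$ is a bare strategy $\tau:T\to A^\perp\parallel N\parallel\boxplus$, that is, a total, polarity-preserving, receptive and innocent map, where $N$ is any event structure all of whose events are neutral and $\boxplus$ is the game with a single Player move $\checkmark$. Let $T_0$ be the restriction of $T$ to the events not mapped into $N$, with the induced map $\tau_0:T_0\to A^\perp\parallel\boxplus$, and let $M_0=\{x\cap T_0\mid x\text{ a }+\text{-maximal configuration of }T\}$. For configurations $x$ of $S$ and $y$ of $T_0$, write $\tau_0y=y_A\parallel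 y_\boxplus$. The configuration $y\circledast x$ of the interaction of $\tau_0$ and $\sigma$ is *defined* if $\sigma x=y_A$ and the induced bijection $\theta: x\parallel y_\boxplus\cong y$ is *secured*: the transitive relation on the pairs in $\theta$ generated by $(s,t)\le(s',t')$ whenever $s\le s'$ in $S\parallel\boxplus$ or $t\le t'$ in $T_0$ is a partial order in which every pair has only finitely many pairs below it. Say that $(\sigma,M)$ *must pass* $\tau$ if $\checkmark\in\tau_0y$ for all $x\in M$ and $y\in M_0$ for which $y\circledast x$ is defined. A *serialisation* of a configuration $x$ of $S$ is a finite or infinite sequence $s_1,s_2,\dots$ without repetition that enumerates $x$ and all of whose initial segments $\{s_1,\dots,s_i\}$ are configurations; then $\sigma(s_1),\sigma(s_2),\dots$ is called a *trace* of $x$ in $\sigma$. **Theorem.** Let $A$ be a race-free, consistent-countable game, and let $(\sigma_1,M_1)$ and $(\sigma_2,M_2)$ be stopping strategies in $A$. Then the following are equivalent: 1. for every test $\tau$ for $A$, if $(\sigma_2,M_2)$ must pass $\tau$ then $(\sigma_1,M_1)$ must pass $\tau$; 2. every (possibly infinite) trace in $\sigma_1$ of a configuration in $M_1$ is a trace in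 $\sigma_2$ of some configuration in $M_2$. -/

import Mathlib

universe u

/-- An event structure on the set of events `E`: a finitary partial order of causal dependency and a
nonempty family `Con` of finite consistent sets. -/
structure EventStructure (E : Type u) where
  le : E → E → Prop
  le_refl : ∀ e, le e e
  le_trans : ∀ e₁ e₂ e₃, le e₁ e₂ → le e₂ e₃ → le e₁ e₃
  le_antisymm : ∀ e₁ e₂, le e₁ e₂ → le e₂ e₁ → e₁ = e₂
  finite_below : ∀ e, {e' | le e' e}.Finite
  Con : Set (Set E)
  con_nonempty : Con.Nonempty
  finite_of_con : ∀ X ∈ Con, X.Finite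
  con_singleton : ∀ e, {e} ∈ Con
  con_subset : ∀ X Y, X ∈ Con → Y ⊆ X → Y ∈ Con
  con_insert : ∀ X e e', X ∈ Con → e' ∈ X → le e e' → insert e X ∈ Con

namespace EventStructure

variable {E F G : Type u}

/-- The (possibly infinite) configurations: consistent, down-closed sets of events. -/
def Config (A : EventStructure E) : Set (Set E) :=
  {x | (∀ X ⊆ x, X.Finite → X ∈ A.Con) ∧ ∀ e e', A.le e' e → e ∈ x → e' ∈ x}

/-- The finite configurations. -/
def FinConfig (A : EventStructure E) : Set (Set E) :=
  {x | x ∈ A.Config ∧ x.Finite}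

/-- Immediate causal dependency. -/
def Covers (A : EventStructure E) (e e' : E) : Prop :=
  e ≠ e' ∧ A.le e e' ∧ ∀ d, A.le e d → A.le d e' → d = e ∨ d = e'

/-- Total maps of event structures. -/
def IsTotalMap (A : EventStructure E) (B : EventStructure F) (f : E → F) : Prop :=
  ∀ x ∈ A.Config, f '' x ∈ B.Config ∧ Set.InjOn f x

def ConsistentCountable (A : EventStructure E) : Prop :=
  ∃ χ : E → ℕ, ∀ e₁ e₂, {e₁, e₂} ∈ A.Con → χ e₁ = χ e₂ → e₁ = e₂

/-- Simple parallel composition: juxtaposition with no dependency or conflict across components. -/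
def par (A : EventStructure E) (B : EventStructure F) : EventStructure (E ⊕ F) where
  le := Sum.LiftRel A.le B.le
  le_refl := by
    rintro (a | b)
    · exact .inl (A.le_refl a)
    · exact .inr (B.le_refl b)
  le_trans := by
    rintro _ _ _ (⟨h⟩ | ⟨h⟩) (⟨h'⟩ | ⟨h'⟩)
    · exact .inl (A.le_trans _ _ _ h h')
    · exact .inr (B.le_trans _ _ _ h h')
  le_antisymm := by
    rintro _ _ (⟨h⟩ | ⟨h⟩) (⟨h'⟩ | ⟨h'⟩)
    · rw [A.le_antisymm _ _ h h']
    · rw [B.le_antisymm _ _ h h']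
  finite_below := by
    rintro (a | b)
    · refine ((A.finite_below a).image Sum.inl).subset ?_
      intro e he
      cases he with
      | inl h => exact ⟨_, h, rfl⟩
    · refine ((B.finite_below b).image Sum.inr).subset ?_
      intro e he
      cases he with
      | inr h => exact ⟨_, h, rfl⟩
  Con := {X | X.Finite ∧ Sum.inl ⁻¹' X ∈ A.Con ∧ Sum.inr ⁻¹' X ∈ B.Con}
  con_nonempty := by
    obtain ⟨X, hX⟩ := A.con_nonempty
    obtain ⟨Y, hY⟩ := B.con_nonempty
    exact ⟨∅, Set.finite_empty, A.con_subset _ _ hX (by simp), B.con_subset _ _ hY (by simp)⟩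
  finite_of_con := fun _ h => h.1
  con_singleton := by
    obtain ⟨X, hX⟩ := A.con_nonempty
    obtain ⟨Y, hY⟩ := B.con_nonempty
    rintro (a | b)
    · exact ⟨Set.finite_singleton _, A.con_subset _ _ (A.con_singleton a) (by intro; simp),
        B.con_subset _ _ hY (by intro; simp)⟩
    · exact ⟨Set.finite_singleton _, A.con_subset _ _ hX (by intro; simp),
        B.con_subset _ _ (B.con_singleton b) (by intro; simp)⟩
  con_subset := fun _ _ hX hYX => ⟨hX.1.subset hYX,
    A.con_subset _ _ hX.2.1 (Set.preimage_mono hYX),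
    B.con_subset _ _ hX.2.2 (Set.preimage_mono hYX)⟩
  con_insert := by
    rintro X _ _ ⟨hf, hA, hB⟩ he' (⟨h⟩ | ⟨h⟩)
    · exact ⟨hf.insert _, A.con_subset _ _ (A.con_insert _ _ _ hA he' h) (by intro; simp),
        B.con_subset _ _ hB (by intro; simp)⟩
    · exact ⟨hf.insert _, A.con_subset _ _ hA (by intro; simp),
        B.con_subset _ _ (B.con_insert _ _ _ hB he' h) (by intro; simp)⟩

/-- The projection of an event structure to a set `V` of visible events. -/
def restrict (A : EventStructure E) (V : Set E) : EventStructure V where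
  le v w := A.le v w
  le_refl v := A.le_refl v
  le_trans _ _ _ h h' := A.le_trans _ _ _ h h'
  le_antisymm _ _ h h' := Subtype.ext (A.le_antisymm _ _ h h')
  finite_below v := (A.finite_below v).preimage Subtype.val_injective.injOn
  Con := {X | Subtype.val '' X ∈ A.Con}
  con_nonempty := by
    obtain ⟨X, hX⟩ := A.con_nonempty
    exact ⟨∅, A.con_subset _ _ hX (by simp)⟩
  finite_of_con X hX := (A.finite_of_con _ hX).of_finite_image Subtype.val_injective.injOn
  con_singleton v := by simpa using A.con_singleton v
  con_subset _ _ hX hYX := A.con_subset _ _ hX (Set.image_mono hYX)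
  con_insert X e e' hX he' h := by
    have := A.con_insert _ e e' hX ⟨e', he', rfl⟩ h
    simpa [Set.image_insert_eq] using this

/-- `s` is a serialisation of the configuration `x`: an enumeration of `x` without repetition,
finite or infinite, all of whose initial segments are finite configurations. -/
structure IsSerialisation (A : EventStructure E) (s : Stream'.Seq E) (x : Set E) : Prop where
  mem_config : x ∈ A.Config
  range_eq : x = {e | ∃ i, s.get? i = some e}
  injective : ∀ i j e, s.get? i = some e → s.get? j = some e → i = j
  initial_mem : ∀ i, (s.get? i).isSome → {e | ∃ j ≤ i, s.get? j = some e} ∈ A.FinConfig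

/-- For total maps `f`, `g` into a common target, the set of pairs that relates `x` and `y` by
`x ≅ f x = g y ≅ y`. -/
def matching (f : E → G) (g : F → G) (x : Set E) (y : Set F) : Set (E × F) :=
  {p | p.1 ∈ x ∧ p.2 ∈ y ∧ f p.1 = g p.2}

/-- The transitive relation on a set `θ` of pairs generated by `(a, b) ≤ (a', b')` whenever
`a ≤ a'` or `b ≤ b'`. -/
def jointLe (A : EventStructure E) (B : EventStructure F) (θ : Set (E × F)) : θ → θ → Prop :=
  Relation.TransGen fun p q => A.le p.1.1 q.1.1 ∨ B.le p.1.2 q.1.2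

/-- `θ` is secured: the generated relation (always reflexive and transitive) is a finitary partial
order. -/
structure IsSecured (A : EventStructure E) (B : EventStructure F) (θ : Set (E × F)) : Prop where
  antisymm : ∀ p q : θ, jointLe A B θ p q → jointLe A B θ q p → p = q
  finite_below : ∀ p : θ, {q | jointLe A B θ q p}.Finite

/-- The partial operation `x ∧ y` of the pullback of `f` and `g` is defined, that is, `x` and `y` are
configurations with `f x = g y` whose induced bijection is secured. (The configurations of the
pullback correspond exactly to these secured bijections.) -/
structure MeetDefined (A : EventStructure E) (B : EventStructure F) (f : E → G) (g : F → G)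
    (x : Set E) (y : Set F) : Prop where
  left_mem : x ∈ A.Config
  right_mem : y ∈ B.Config
  image_eq : f '' x = g '' y
  secured : IsSecured A B (matching f g x y)

end EventStructure

/-- Player `pos`, Opponent `neg`, neutral `zero`. -/
inductive Polarity
  | pos
  | neg
  | zero

/-- Reversal of the roles of Player and Opponent. -/
def Polarity.dual : Polarity → Polarity
  | pos => neg
  | neg => pos
  | zero => zero

/-- Event structures with polarity. -/
structure PolarES (E : Type u) extends EventStructure E where
  pol : E → Polarity

namespace PolarES

variable {E F : Type u}

/-- A game has no neutral moves. -/
def IsGame (A : PolarES E) : Prop :=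
  ∀ a, A.pol a ≠ .zero

/-- All events are neutral. -/
def IsNeutral (N : PolarES E) : Prop :=
  ∀ n, N.pol n = .zero

/-- The dual, with polarities reversed. -/
def dual (A : PolarES E) : PolarES E where
  toEventStructure := A.toEventStructure
  pol a := (A.pol a).dual

/-- Simple parallel composition, polarities unchanged. -/
def par (A : PolarES E) (B : PolarES F) : PolarES (E ⊕ F) where
  toEventStructure := A.toEventStructure.par B.toEventStructure
  pol := Sum.elim A.pol B.pol

/-- `x ⊆⁻ y`: inclusion in which all intervening events are Opponent moves. -/
def NegSubset (A : PolarES E) (x y : Set E) : Prop :=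
  x ⊆ y ∧ ∀ e ∈ y \ x, A.pol e = .neg

/-- `x ⊆⁺ y`: inclusion in which all intervening events are neutral or Player moves. -/
def PosSubset (A : PolarES E) (x y : Set E) : Prop :=
  x ⊆ y ∧ ∀ e ∈ y \ x, A.pol e = .pos ∨ A.pol e = .zero

/-- The +-maximal configurations. -/
def PosMaximal (A : PolarES E) (x : Set E) : Prop :=
  x ∈ A.Config ∧ ∀ y ∈ A.Config, A.PosSubset x y → y = x

def RaceFree (A : PolarES E) : Prop :=
  ∀ x ∈ A.Config, ∀ y ∈ A.Config, ∀ z ∈ A.Config,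
    A.PosSubset x y → A.NegSubset x z → y ∪ z ∈ A.Config

/-- A total map of event structures with polarity that is receptive and innocent. A bare strategy from
`A` to `B` is such a map into `A^⊥ ∥ N ∥ B` with `N` neutral; a strategy in a game `A` is such a map
into `A`. -/
structure IsStrategyMap (S : PolarES E) (A : PolarES F) (σ : E → F) : Prop where
  total_map : S.IsTotalMap A.toEventStructure σ
  pol_eq : ∀ s, A.pol (σ s) = S.pol s
  receptive : ∀ x ∈ S.FinConfig, ∀ y ∈ A.FinConfig, A.NegSubset (σ '' x) y →
    ∃! x', x' ∈ S.FinConfig ∧ x ⊆ x' ∧ σ '' x' = y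
  pos_innocent : ∀ s s', S.Covers s s' → S.pol s = .pos → A.Covers (σ s) (σ s')
  neg_innocent : ∀ s s', S.Covers s s' → S.pol s' = .neg → A.Covers (σ s) (σ s')

/-- The game consisting of a single Player move. -/
def playerMove : PolarES PUnit.{u + 1} where
  le _ _ := True
  le_refl _ := trivial
  le_trans _ _ _ _ _ := trivial
  le_antisymm _ _ _ _ := rfl
  finite_below _ := Set.toFinite _
  Con := Set.univ
  con_nonempty := Set.univ_nonempty
  finite_of_con _ _ := Set.toFinite _
  con_singleton _ := trivial
  con_subset _ _ _ _ := trivial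
  con_insert _ _ _ _ _ _ := trivial
  pol _ := .pos

end PolarES

/-- A bare strategy from `A` to `B`, a map into `A^⊥ ∥ N ∥ B`. -/
structure BareStrategy {E F : Type u} (A : PolarES E) (B : PolarES F) where
  NEvent : Type u
  N : PolarES NEvent
  neutral : N.IsNeutral
  Event : Type u
  S : PolarES Event
  map : Event → E ⊕ NEvent ⊕ F
  isStrategyMap : S.IsStrategyMap (A.dual.par (N.par B)) map

namespace BareStrategy

variable {E F : Type u} {A : PolarES E} {B : PolarES F}

/-- The partial projection `A^⊥ ∥ N ∥ B → A^⊥ ∥ B` on events. -/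
def hide {E N F : Type u} : E ⊕ N ⊕ F → Option (E ⊕ F)
  | .inl a => some (.inl a)
  | .inr (.inl _) => none
  | .inr (.inr b) => some (.inr b)

/-- The events on which the composite with the projection is defined. -/
def visible (τ : BareStrategy A B) : Set τ.Event :=
  {t | (hide (τ.map t)).isSome}

/-- The event structure of the visible part. -/
def visES (τ : BareStrategy A B) : EventStructure τ.visible :=
  τ.S.toEventStructure.restrict τ.visible

/-- The visible part of a bare strategy, as a map into `A^⊥ ∥ B`. -/
def visMap (τ : BareStrategy A B) (t : τ.visible) : E ⊕ F :=
  (hide (τ.map t)).get t.2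

/-- The stopping configurations of a bare strategy: visible images of +-maximal configurations. -/
def Stop (τ : BareStrategy A B) : Set (Set τ.visible) :=
  {y | ∃ x, τ.S.PosMaximal x ∧ y = (Subtype.val ⁻¹' x : Set τ.visible)}

end BareStrategy

/-- A test for strategies in `A`: a bare strategy from `A` to the game with a single Player move. -/
abbrev Test {E : Type u} (A : PolarES E) := BareStrategy A PolarES.playerMove.{u}

/-- A stopping strategy in `A`: a strategy in `A` with an arbitrary set of stopping configurations. -/
structure StoppingStrategy {E : Type u} (A : PolarES E) where
  Event : Type u
  S : PolarES Event
  map : Event → E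
  isStrategyMap : S.IsStrategyMap A map
  M : Set (Set Event)
  M_subset : M ⊆ S.Config

namespace StoppingStrategy

variable {E : Type u} {A : PolarES E}

/-- For `x` in a strategy `σ : S → A` and `y` in the visible part `τ₀ : T₀ → A^⊥ ∥ B` of `τ`, the
configuration `y ⊛ x = (x ∥ y_B) ∧ y` of the interaction of `τ₀` and `σ` is defined. The interaction
is the pullback of `σ ∥ B : S ∥ B → A ∥ B` and `τ₀`. -/
def InteractionDefined {F : Type u} {B : PolarES F} (σ : StoppingStrategy A) (τ : BareStrategy A B)
    (y : Set τ.visible) (x : Set σ.Event) : Prop :=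
  EventStructure.MeetDefined (σ.S.toEventStructure.par B.toEventStructure) τ.visES
    (Sum.map σ.map id) τ.visMap
    (Sum.inl '' x ∪ Sum.inr '' {b | Sum.inr b ∈ τ.visMap '' y}) y

/-- `σ` must pass `τ`: every stopping configuration `y ⊛ x` of the interaction has an image that
contains the success move. -/
def MustPass (σ : StoppingStrategy A) (τ : Test A) : Prop :=
  ∀ x ∈ σ.M, ∀ y ∈ τ.Stop, σ.InteractionDefined τ y x →
    Sum.inr PUnit.unit ∈ τ.visMap '' y

/-- `α` is a trace of the configuration `x` in `σ`. -/
def IsTrace (σ : StoppingStrategy A) (α : Stream'.Seq E) (x : Set σ.Event) : Prop :=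
  ∃ s : Stream'.Seq σ.Event, σ.S.IsSerialisation s x ∧ α = s.map σ.map

end StoppingStrategy

/-!
Must-testing is trace inclusion because both an interaction and a trace are, up to a choice of
enumeration, the same thing. An interaction of a configuration with a run of a test is defined exactly
when strategy and test play the same moves and a single enumeration of these moves respects causal
dependency on both sides (`StoppingStrategy.interactionDefined_iff`). Here countability of the
configurations of the game is used: a countable finitary partial order has a linearisation of order
type at most `ω` (`EventStructure.exists_rank_of_isSecured`).

If traces are included, the enumeration of an interaction of `x₁` with a test gives a trace of `x₁`;
it is a trace of some `x₂`, and the same enumeration shows that `x₂` interacts with the same run of the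
test (`StoppingStrategy.mustPass_of_forall_isTrace`).

Conversely, every trace `α` has a test (`RankedConfig.test`) that a strategy fails if and only if it has
the trace `α`. The test plays the Opponent moves of `α`, each after all Player moves that precede it in
`α`, and receives Player moves as it must. Success is available at the start for each Player move `p`
of `α`, until a neutral event caused by `p` disables it, and after every Player move outside `α`. So a
+-maximal run without success has played exactly the moves of `α`
(`RankedConfig.movesOf_eq_of_posMaximal`). Such a run interacts with a strategy only if the strategy has
the trace `α` (`RankedConfig.mustPass_test_of_not_isTrace`): by innocence, an immediate causal
dependency of the strategy either comes from the game, and is then respected by `α`, or leads from an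
Opponent move to a Player move; were it against the order of `α`, the test would have the opposite
dependency and the interaction would have a causal cycle.
-/

namespace EventStructure

variable {E F G : Type u}

/-! ### Secured bijections and rankings -/

theorem isSecured_of_rank {A : EventStructure E} {B : EventStructure F} {f : E → G} {g : F → G}
    {x : Set E} {y : Set F} (hf : Set.InjOn f x) (hg : Set.InjOn g y) (ρ : G → ℕ)
    (hρ : Set.InjOn ρ (f '' x))
    (hA : ∀ a ∈ x, ∀ a' ∈ x, A.le a a' → ρ (f a) ≤ ρ (f a'))
    (hB : ∀ b ∈ y, ∀ b' ∈ y, B.le b b' → ρ (g b) ≤ ρ (g b')) :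
    IsSecured A B (matching f g x y) := by
  have key : ∀ p q : matching f g x y, jointLe A B _ p q → ρ (f p.1.1) ≤ ρ (f q.1.1) := by
    intro p q h
    induction h with
    | @single q h =>
      rcases h with h | h
      · exact hA _ p.2.1 _ q.2.1 h
      · rw [p.2.2.2, q.2.2.2]
        exact hB _ p.2.2.1 _ q.2.2.1 h
    | @tail q r _ h ih =>
      refine ih.trans ?_
      rcases h with h | h
      · exact hA _ q.2.1 _ r.2.1 h
      · rw [q.2.2.2, r.2.2.2]
        exact hB _ q.2.2.1 _ r.2.2.1 h
  have inj : Function.Injective fun p : matching f g x y => ρ (f p.1.1) := by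
    intro p q h
    have h₁ : f p.1.1 = f q.1.1 := hρ ⟨_, p.2.1, rfl⟩ ⟨_, q.2.1, rfl⟩ h
    refine Subtype.ext (Prod.ext (hf p.2.1 q.2.1 h₁) (hg p.2.2.1 q.2.2.1 ?_))
    rw [← p.2.2.2, ← q.2.2.2, h₁]
  refine ⟨fun p q h h' => inj (_root_.le_antisymm (key _ _ h) (key _ _ h')), fun p => ?_⟩
  exact ((Set.finite_Iic (ρ (f p.1.1))).preimage inj.injOn).subset fun q hq => key _ _ hq

/-- A countable secured bijection has a linearisation of order type at most `ω`, given as a ranking of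
the common image. -/
theorem exists_rank_of_isSecured {A : EventStructure E} {B : EventStructure F} {f : E → G}
    {g : F → G} {x : Set E} {y : Set F} (hf : Set.InjOn f x) (hg : Set.InjOn g y)
    (hxy : f '' x = g '' y) (hc : (f '' x).Countable) (h : IsSecured A B (matching f g x y)) :
    ∃ ρ : G → ℕ, Set.InjOn ρ (f '' x) ∧
      (∀ a ∈ x, ∀ a' ∈ x, A.le a a' → ρ (f a) ≤ ρ (f a')) ∧
      ∀ b ∈ y, ∀ b' ∈ y, B.le b b' → ρ (g b) ≤ ρ (g b') := by
  classical
  have inj : ∀ p q : matching f g x y, f p.1.1 = f q.1.1 → p = q := fun p q e =>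
    Subtype.ext (Prod.ext (hf p.2.1 q.2.1 e)
      (hg p.2.2.1 q.2.2.1 (by rw [← p.2.2.2, ← q.2.2.2, e])))
  have hcθ : Countable (matching f g x y) := by
    have := hc.to_subtype
    exact Function.Injective.countable
      (f := fun p : matching f g x y => (⟨f p.1.1, p.1.1, p.2.1, rfl⟩ : f '' x))
      fun p q e => inj p q (congrArg Subtype.val e)
  obtain ⟨e, he⟩ := exists_injective_nat (matching f g x y)
  -- A pair is ranked by the binary number whose digits mark the pairs below it.
  let r : matching f g x y → ℕ := fun p =>
    ∑ i ∈ (h.finite_below p).toFinset.map ⟨e, he⟩, 2 ^ i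
  have r_inj : Function.Injective r := by
    intro p q hpq
    have h₁ := Finset.map_injective _ (Finset.geomSum_injective le_rfl hpq)
    have h₂ : ∀ s, jointLe A B _ s p ↔ jointLe A B _ s q := fun s => by
      simpa using (Finset.ext_iff.1 h₁) s
    exact h.antisymm _ _ ((h₂ p).1 (.single (.inl (A.le_refl _))))
      ((h₂ q).2 (.single (.inl (A.le_refl _))))
  have r_mono : ∀ p q, jointLe A B _ p q → r p ≤ r q := fun p q hpq => by
    refine Finset.sum_le_sum_of_subset (Finset.map_subset_map.2 fun s hs => ?_)
    simp only [Set.Finite.mem_toFinset, Set.mem_ofPred_eq] at hs ⊢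
    exact Relation.TransGen.trans hs hpq
  let ρ : G → ℕ := fun w => if h : ∃ p : matching f g x y, f p.1.1 = w then r h.choose else 0
  have hρ : ∀ p : matching f g x y, ρ (f p.1.1) = r p := fun p => by
    have hp : ∃ q : matching f g x y, f q.1.1 = f p.1.1 := ⟨p, rfl⟩
    simp only [ρ, dif_pos hp]
    rw [inj _ _ hp.choose_spec]
  have left : ∀ a ∈ x, ∃ p : matching f g x y, p.1.1 = a := fun a ha => by
    obtain ⟨b, hb, hab⟩ : f a ∈ g '' y := hxy ▸ ⟨a, ha, rfl⟩
    exact ⟨⟨(a, b), ha, hb, hab.symm⟩, rfl⟩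
  have right : ∀ b ∈ y, ∃ p : matching f g x y, p.1.2 = b := fun b hb => by
    obtain ⟨a, ha, hab⟩ : g b ∈ f '' x := hxy ▸ ⟨b, hb, rfl⟩
    exact ⟨⟨(a, b), ha, hb, hab⟩, rfl⟩
  refine ⟨ρ, ?_, ?_, ?_⟩
  · rintro _ ⟨a, ha, rfl⟩ _ ⟨a', ha', rfl⟩ haa
    obtain ⟨p, rfl⟩ := left a ha
    obtain ⟨q, rfl⟩ := left a' ha'
    rw [hρ, hρ] at haa
    rw [r_inj haa]
  · intro a ha a' ha' haa
    obtain ⟨p, rfl⟩ := left a ha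
    obtain ⟨q, rfl⟩ := left a' ha'
    rw [hρ, hρ]
    exact r_mono _ _ (.single (.inl haa))
  · intro b hb b' hb' hbb
    obtain ⟨p, rfl⟩ := right b hb
    obtain ⟨q, rfl⟩ := right b' hb'
    rw [← p.2.2.2, ← q.2.2.2, hρ, hρ]
    exact r_mono _ _ (.single (.inr hbb))

/-! ### Configurations -/

theorem mem_config_of_subset {A : EventStructure E} {x y : Set E} (hy : y ∈ A.Config) (hxy : x ⊆ y)
    (h : ∀ e e', A.le e' e → e ∈ x → e' ∈ x) : x ∈ A.Config :=
  ⟨fun X hX hf => hy.1 X (hX.trans hxy) hf, h⟩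

theorem par_mem_config {A : EventStructure E} {B : EventStructure F} {x : Set E} {y : Set F}
    (hx : x ∈ A.Config) (hy : y ∈ B.Config) :
    Sum.inl '' x ∪ Sum.inr '' y ∈ (A.par B).Config := by
  refine ⟨fun X hX hf => ⟨hf, hx.1 _ ?_ (hf.preimage Sum.inl_injective.injOn),
    hy.1 _ ?_ (hf.preimage Sum.inr_injective.injOn)⟩, ?_⟩
  · intro a ha
    simpa using hX ha
  · intro b hb
    simpa using hX hb
  · rintro _ _ (⟨h⟩ | ⟨h⟩) he
    · exact .inl ⟨_, hx.2 _ _ h (by simpa using he), rfl⟩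
    · exact .inr ⟨_, hy.2 _ _ h (by simpa using he), rfl⟩

theorem restrict_mem_config {A : EventStructure E} {x : Set E} (hx : x ∈ A.Config) (V : Set E) :
    (Subtype.val ⁻¹' x : Set V) ∈ (A.restrict V).Config :=
  ⟨fun _ hX hf => hx.1 _ (Set.image_subset_iff.2 hX) (hf.image _), fun _ _ h he => hx.2 _ _ h he⟩

/-- In a finitary partial order, causal dependency is generated by immediate causal dependency. -/
theorem covers_induction (A : EventStructure E) {R : E → E → Prop} (hrefl : ∀ e, R e e)
    (htrans : ∀ e₁ e₂ e₃, R e₁ e₂ → R e₂ e₃ → R e₁ e₃) {x : Set E} (hx : x ∈ A.Config)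
    (hcov : ∀ e e', e' ∈ x → A.Covers e e' → R e e') {a b : E} (hab : A.le a b) (hb : b ∈ x) :
    R a b := by
  induction hn : {d | A.le a d ∧ A.le d b}.ncard using Nat.strong_induction_on
    generalizing a b with
  | _ n ih =>
    have fin : {d | A.le a d ∧ A.le d b}.Finite :=
      (A.finite_below b).subset fun d hd => hd.2
    by_cases hc : ∀ d, A.le a d → A.le d b → d = a ∨ d = b
    · by_cases hne : a = b
      · exact hne ▸ hrefl a
      · exact hcov a b hb ⟨hne, hab, hc⟩
    · push Not at hc
      obtain ⟨d, had, hdb, hda, hdb'⟩ := hc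
      have h₁ : {e | A.le a e ∧ A.le e d} ⊂ {e | A.le a e ∧ A.le e b} :=
        ⟨fun e he => ⟨he.1, A.le_trans _ _ _ he.2 hdb⟩, fun h =>
          hdb' (A.le_antisymm _ _ hdb (h ⟨hab, A.le_refl b⟩).2)⟩
      have h₂ : {e | A.le d e ∧ A.le e b} ⊂ {e | A.le a e ∧ A.le e b} :=
        ⟨fun e he => ⟨A.le_trans _ _ _ had he.1, he.2⟩, fun h =>
          hda (A.le_antisymm _ _ (h ⟨A.le_refl a, hab⟩).1 had)⟩
      exact htrans _ d _
        (ih _ (hn ▸ Set.ncard_lt_ncard h₁ fin) had (hx.2 _ _ hdb hb) rfl)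
        (ih _ (hn ▸ Set.ncard_lt_ncard h₂ fin) hdb hb rfl)

/-! ### Serialisations -/

theorem isSerialisation_of_index {A : EventStructure E} {s : Stream'.Seq E} {x : Set E} {k : E → ℕ}
    (hx : x ∈ A.Config) (hs : ∀ i e, s.get? i = some e ↔ e ∈ x ∧ k e = i)
    (hk : ∀ a b, A.le a b → b ∈ x → k a ≤ k b) : A.IsSerialisation s x where
  mem_config := hx
  range_eq := by
    ext e
    simp [hs]
  injective i j e hi hj := ((hs i e).1 hi).2.symm.trans ((hs j e).1 hj).2
  initial_mem i _ := by
    simp only [hs]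
    refine ⟨mem_config_of_subset hx ?_ ?_, ?_⟩
    · rintro e ⟨_, _, he, _⟩
      exact he
    · rintro e e' hle ⟨j, hj, he, rfl⟩
      exact ⟨k e', (hk _ _ hle he).trans hj, hx.2 _ _ hle he, rfl⟩
    · refine Set.Finite.of_finite_image ((Set.finite_Iic i).subset ?_) (f := k) ?_
      · rintro _ ⟨e, ⟨j, hj, _, rfl⟩, rfl⟩
        exact hj
      · rintro a ⟨_, _, ha, rfl⟩ b ⟨_, _, hb, rfl⟩ hab
        have h := (hs _ _).2 ⟨ha, hab⟩
        rw [(hs _ _).2 ⟨hb, rfl⟩] at h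
        exact (Option.some_injective _ h).symm

theorem IsSerialisation.exists_index {A : EventStructure E} {s : Stream'.Seq E} {x : Set E}
    (h : A.IsSerialisation s x) : ∃ k : E → ℕ, (∀ i e, s.get? i = some e ↔ e ∈ x ∧ k e = i) ∧
      ∀ i, {e | e ∈ x ∧ k e ≤ i} ∈ A.Config := by
  classical
  have hx : ∀ e, e ∈ x ↔ ∃ i, s.get? i = some e := fun e => by
    conv_lhs => rw [h.range_eq]
    rfl
  let k : E → ℕ := fun e => if h : ∃ i, s.get? i = some e then h.choose else 0
  have hs : ∀ i e, s.get? i = some e ↔ e ∈ x ∧ k e = i := by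
    intro i e
    constructor
    · intro hi
      have he : ∃ i, s.get? i = some e := ⟨i, hi⟩
      refine ⟨(hx e).2 he, ?_⟩
      simp only [k, dif_pos he]
      exact h.injective _ _ _ he.choose_spec hi
    · rintro ⟨he, rfl⟩
      have he' := (hx e).1 he
      simp only [k, dif_pos he']
      exact he'.choose_spec
  refine ⟨k, hs, fun i => ?_⟩
  refine mem_config_of_subset h.mem_config (fun e he => he.1) ?_
  rintro e e' hle ⟨he, hi⟩
  have h₁ := (hs (k e) e).2 ⟨he, rfl⟩
  obtain ⟨j, hj, hj'⟩ :=
    (h.initial_mem (k e) (by simp [h₁])).1.2 e e' hle ⟨k e, le_rfl, h₁⟩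
  exact ⟨((hs _ _).1 hj').1, ((hs _ _).1 hj').2.trans_le (hj.trans hi)⟩

/-- A configuration with an injective monotone numbering is serialised in the order of the
numbering. -/
theorem exists_serialisation_of_rank {A : EventStructure E} {x : Set E} (hx : x ∈ A.Config)
    {h : E → ℕ} (hinj : Set.InjOn h x) (hmono : ∀ a ∈ x, ∀ b ∈ x, A.le a b → h a ≤ h b) :
    ∃ s, A.IsSerialisation s x ∧
      ∀ i j a b, s.get? i = some a → s.get? j = some b → i ≤ j → h a ≤ h b := by
  classical
  let p : ℕ → Prop := fun n => n ∈ h '' x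
  let k : E → ℕ := fun e => Nat.count p (h e)
  have k_inj : ∀ a ∈ x, ∀ b ∈ x, k a = k b → a = b := fun a ha b hb hab =>
    hinj ha hb (Nat.count_injective ⟨a, ha, rfl⟩ ⟨b, hb, rfl⟩ hab)
  let f : ℕ → Option E := fun i => if h : ∃ e ∈ x, k e = i then some h.choose else none
  have hf : ∀ i e, f i = some e ↔ e ∈ x ∧ k e = i := by
    intro i e
    by_cases hi : ∃ e ∈ x, k e = i
    · simp only [f, dif_pos hi, Option.some.injEq]
      have hs := hi.choose_spec
      constructor
      · rintro rfl
        exact hs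
      · rintro ⟨he, rfl⟩
        exact k_inj _ hs.1 _ he hs.2
    · simp only [f, dif_neg hi, reduceCtorEq, false_iff]
      exact fun h => hi ⟨e, h⟩
  have f_seq : Stream'.IsSeq (α := E) f := by
    intro i hi
    change f i = none at hi
    by_contra hne
    obtain ⟨e, he⟩ := Option.ne_none_iff_exists'.1 hne
    obtain ⟨hex, hk⟩ := (hf _ _).1 he
    have hn : ∀ hp : (Set.ofPred p).Finite, i < hp.toFinset.card := fun hp => by
      have := Nat.count_lt_card hp (n := h e) ⟨e, hex, rfl⟩
      exact lt_of_lt_of_le (show i < k e by omega) this.le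
    obtain ⟨e', he', hee⟩ := Nat.nth_mem i hn
    have : f i = some e' := (hf _ _).2 ⟨he', by
      simp only [k, hee]
      exact Nat.count_nth hn⟩
    rw [this] at hi
    exact Option.some_ne_none _ hi
  refine ⟨⟨f, f_seq⟩, isSerialisation_of_index hx (k := k) hf ?_, ?_⟩
  · intro a b hab hb
    exact Nat.count_monotone p (hmono a (hx.2 _ _ hab hb) b hb hab)
  · intro i j a b hi hj hij
    obtain ⟨ha, rfl⟩ := (hf _ _).1 hi
    obtain ⟨hb, rfl⟩ := (hf _ _).1 hj
    by_contra hlt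
    have := Nat.count_strict_mono (p := p) (m := h b) ⟨b, hb, rfl⟩ (not_le.1 hlt)
    exact absurd hij (not_le.2 this)

theorem ConsistentCountable.countable_of_mem_config {A : EventStructure E}
    (h : A.ConsistentCountable) {x : Set E} (hx : x ∈ A.Config) : x.Countable := by
  obtain ⟨χ, hχ⟩ := h
  refine Set.MapsTo.countable_of_injOn (f := χ) (t := Set.univ) (fun _ _ => trivial) ?_
    Set.countable_univ
  intro a ha b hb hab
  exact hχ a b (hx.1 _ (by simp [Set.insert_subset_iff, ha, hb]) (Set.toFinite _)) hab

end EventStructure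

/-! ### Interactions of strategies and tests -/

theorem PolarES.playerMove_mem_config (Y : Set PUnit.{u + 1}) :
    Y ∈ PolarES.playerMove.{u}.Config :=
  ⟨fun _ _ _ => trivial, fun _ _ _ h => h⟩

namespace BareStrategy

variable {E F : Type u} {A : PolarES E} {B : PolarES F} (τ : BareStrategy A B)

theorem hide_visMap (t : τ.visible) : hide (τ.map t) = some (τ.visMap t) :=
  (Option.some_get t.2).symm

theorem hide_injective {E N F : Type u} {a b : E ⊕ N ⊕ F} {c : E ⊕ F} (ha : hide a = some c)
    (hb : hide b = some c) : a = b := by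
  rcases a with a | a | a <;> rcases b with b | b | b <;> simp_all [hide] <;> aesop

theorem visMap_injOn {z : Set τ.Event} (hz : z ∈ τ.S.Config) :
    Set.InjOn τ.visMap (Subtype.val ⁻¹' z) := fun t ht t' ht' h =>
  Subtype.ext ((τ.isStrategyMap.total_map z hz).2 ht ht'
    (hide_injective (τ.hide_visMap t) (by rw [h, τ.hide_visMap t'])))

theorem inl_mem_image_visMap {z : Set τ.Event} {a : E} :
    Sum.inl a ∈ τ.visMap '' (Subtype.val ⁻¹' z) ↔ Sum.inl a ∈ τ.map '' z := by
  constructor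
  · rintro ⟨t, ht, h⟩
    exact ⟨t, ht, hide_injective (τ.hide_visMap t) (by rw [h]; rfl)⟩
  · rintro ⟨t, ht, h⟩
    have hv : t ∈ τ.visible := by simp [visible, h, hide]
    refine ⟨⟨t, hv⟩, ht, Option.some_injective _ ?_⟩
    rw [← τ.hide_visMap, h]
    rfl

theorem inr_mem_image_visMap {z : Set τ.Event} {b : F} :
    Sum.inr b ∈ τ.visMap '' (Subtype.val ⁻¹' z) ↔ Sum.inr (Sum.inr b) ∈ τ.map '' z := by
  constructor
  · rintro ⟨t, ht, h⟩
    exact ⟨t, ht, hide_injective (τ.hide_visMap t) (by rw [h]; rfl)⟩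
  · rintro ⟨t, ht, h⟩
    have hv : t ∈ τ.visible := by simp [visible, h, hide]
    refine ⟨⟨t, hv⟩, ht, Option.some_injective _ ?_⟩
    rw [← τ.hide_visMap, h]
    rfl

end BareStrategy

namespace StoppingStrategy

variable {E : Type u} {A : PolarES E}

/-- An interaction is defined when strategy and test agree on the moves of the game and both
respect one common enumeration of the moves played. -/
theorem interactionDefined_iff (hcount : A.ConsistentCountable) (σ : StoppingStrategy A)
    (τ : Test A) {x : Set σ.Event} (hx : x ∈ σ.S.Config) {z : Set τ.Event}
    (hz : z ∈ τ.S.Config) :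
    σ.InteractionDefined τ (Subtype.val ⁻¹' z) x ↔
      (∀ a, Sum.inl a ∈ τ.map '' z ↔ a ∈ σ.map '' x) ∧
      ∃ ρ : E ⊕ PUnit.{u + 1} → ℕ, Set.InjOn ρ (τ.visMap '' (Subtype.val ⁻¹' z)) ∧
        (∀ s ∈ x, ∀ s' ∈ x, σ.S.le s s' → ρ (.inl (σ.map s)) ≤ ρ (.inl (σ.map s'))) ∧
        ∀ t t' : τ.visible, t.1 ∈ z → t'.1 ∈ z → τ.S.le t t' →
          ρ (τ.visMap t) ≤ ρ (τ.visMap t') := by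
  set y : Set τ.visible := Subtype.val ⁻¹' z
  set Y : Set PUnit.{u + 1} := {b | Sum.inr b ∈ τ.visMap '' y}
  have himg : Sum.map σ.map id '' (Sum.inl '' x ∪ Sum.inr '' Y) =
      (Sum.inl '' (σ.map '' x) ∪ Sum.inr '' Y : Set (E ⊕ PUnit.{u + 1})) := by
    simp [Set.image_union, Set.image_image]
  have heq : Sum.map σ.map id '' (Sum.inl '' x ∪ Sum.inr '' Y) = τ.visMap '' y ↔
      ∀ a, Sum.inl a ∈ τ.map '' z ↔ a ∈ σ.map '' x := by
    rw [himg, Set.ext_iff, Sum.forall]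
    have h₂ : ∀ b : PUnit.{u + 1}, (Sum.inr b ∈ (Sum.inl '' (σ.map '' x) ∪ Sum.inr '' Y :
        Set (E ⊕ PUnit.{u + 1})) ↔ Sum.inr b ∈ τ.visMap '' y) := fun b => by
      constructor
      · rintro (⟨a, -, h⟩ | ⟨b, hb, -⟩)
        · cases h
        · exact hb
      · exact fun hb => .inr ⟨b, hb, rfl⟩
    have h₁ : ∀ a, (Sum.inl a ∈ (Sum.inl '' (σ.map '' x) ∪ Sum.inr '' Y :
        Set (E ⊕ PUnit.{u + 1})) ↔ a ∈ σ.map '' x) := fun a => by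
      simp
    simp only [h₁, h₂, implies_true, and_true]
    refine forall_congr' fun a => ?_
    rw [τ.inl_mem_image_visMap]
    exact iff_comm
  have hσ := σ.isStrategyMap.total_map x hx
  have hf : Set.InjOn (Sum.map σ.map (id : PUnit.{u + 1} → _)) (Sum.inl '' x ∪ Sum.inr '' Y) := by
    rintro _ (⟨s, hs, rfl⟩ | ⟨b, hb, rfl⟩) _ (⟨s', hs', rfl⟩ | ⟨b', hb', rfl⟩) h
    · rw [hσ.2 hs hs' (Sum.inl_injective h)]
    · simp at h
    · simp at h
    · rfl
  have hg := τ.visMap_injOn hz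
  have hc : (Sum.map σ.map (id : PUnit.{u + 1} → _) '' (Sum.inl '' x ∪ Sum.inr '' Y)).Countable := by
    rw [himg]
    exact ((hcount.countable_of_mem_config hσ.1).image _).union (Set.to_countable _)
  constructor
  · intro h
    have himage : _ = τ.visMap '' y := h.image_eq
    obtain ⟨ρ, h₁, h₂, h₃⟩ :=
      EventStructure.exists_rank_of_isSecured hf hg h.image_eq hc h.secured
    rw [himage] at h₁
    exact ⟨heq.1 h.image_eq, ρ, h₁,
      fun s hs s' hs' hle => h₂ _ (.inl ⟨s, hs, rfl⟩) _ (.inl ⟨s', hs', rfl⟩) (.inl hle),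
      fun t t' ht ht' hle => h₃ t ht t' ht' hle⟩
  · rintro ⟨h, ρ, h₁, h₂, h₃⟩
    have himage := heq.2 h
    refine ⟨EventStructure.par_mem_config hx (PolarES.playerMove_mem_config _),
      EventStructure.restrict_mem_config hz _, himage,
      EventStructure.isSecured_of_rank hf hg ρ (by rwa [himage]) ?_
        fun t ht t' ht' hle => h₃ t t' ht ht' hle⟩
    rintro _ (⟨s, hs, rfl⟩ | ⟨b, hb, rfl⟩) _ (⟨s', hs', rfl⟩ | ⟨b', hb', rfl⟩) hle
    · exact h₂ s hs s' hs' (Sum.liftRel_inl_inl.1 hle)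
    · exact absurd hle Sum.not_liftRel_inl_inr
    · exact absurd hle Sum.not_liftRel_inr_inl
    · exact le_rfl

end StoppingStrategy

/-! ### The test for a trace -/

/-- A configuration of `A` together with the order in which one of its traces enumerates it. -/
structure RankedConfig {E : Type u} (A : PolarES E) where
  carrier : Set E
  rank : E → ℕ
  mem_config : carrier ∈ A.Config
  injOn : Set.InjOn rank carrier
  mono : ∀ a b, A.le a b → b ∈ carrier → rank a ≤ rank b

namespace RankedConfig

variable {E : Type u} {A : PolarES E} (W : RankedConfig A)

/-- Causal dependency in the test: that of the game, together with the dependency of each Opponent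
move of the trace on all Player moves that precede it in the trace. -/
def Dep (a b : E) : Prop :=
  A.le a b ∨ ∃ c ∈ W.carrier, ∃ d ∈ W.carrier,
    A.pol c = .pos ∧ A.pol d = .neg ∧ W.rank c < W.rank d ∧ A.le a c ∧ A.le d b

/-- The moves of the game that occur in the test: those that depend on no Opponent move outside the
trace, and whose dependencies in the test are consistent in the game. Consistency can fail for a Player
move outside the trace that depends on an Opponent move of the trace and conflicts with an earlier
Player move of the trace. -/
def moves : Set E :=
  {a | (∀ c, A.le c a → A.pol c = .neg → c ∈ W.carrier) ∧ {b | W.Dep b a} ∈ A.Con}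

variable {W}

theorem Dep.refl (a : E) : W.Dep a a := .inl (A.le_refl a)

theorem Dep.of_rank_lt {c d : E} (hc : c ∈ W.carrier) (hd : d ∈ W.carrier) (hcp : A.pol c = .pos)
    (hdn : A.pol d = .neg) (h : W.rank c < W.rank d) : W.Dep c d :=
  .inr ⟨c, hc, d, hd, hcp, hdn, h, A.le_refl c, A.le_refl d⟩

theorem Dep.mem {a b : E} (h : W.Dep a b) (hb : b ∈ W.carrier) : a ∈ W.carrier := by
  rcases h with h | ⟨c, hc, d, hd, -, -, -, hac, -⟩
  · exact W.mem_config.2 _ _ h hb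
  · exact W.mem_config.2 _ _ hac hc

theorem Dep.rank_le {a b : E} (h : W.Dep a b) (hb : b ∈ W.carrier) : W.rank a ≤ W.rank b := by
  rcases h with h | ⟨c, hc, d, hd, -, -, hlt, hac, hdb⟩
  · exact W.mono _ _ h hb
  · exact (W.mono _ _ hac hc).trans (hlt.le.trans (W.mono _ _ hdb hb))

theorem Dep.trans {a b c : E} (h : W.Dep a b) (h' : W.Dep b c) : W.Dep a c := by
  rcases h with h | ⟨d, hd, e, he, hp, hn, hlt, h₁, h₂⟩
  · rcases h' with h' | ⟨d', hd', e', he', hp', hn', hlt', h₁', h₂'⟩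
    · exact .inl (A.le_trans _ _ _ h h')
    · exact .inr ⟨d', hd', e', he', hp', hn', hlt', A.le_trans _ _ _ h h₁', h₂'⟩
  · rcases h' with h' | ⟨d', hd', e', he', hp', hn', hlt', h₁', h₂'⟩
    · exact .inr ⟨d, hd, e, he, hp, hn, hlt, h₁, A.le_trans _ _ _ h₂ h'⟩
    · exact .inr ⟨d, hd, e', he', hp, hn',
        hlt.trans_le ((W.mono _ _ (A.le_trans _ _ _ h₂ h₁') hd').trans hlt'.le), h₁, h₂'⟩

theorem Dep.antisymm {a b : E} (h : W.Dep a b) (h' : W.Dep b a) : a = b := by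
  -- A dependency cycle through the trace would have a Player move of smaller rank than itself.
  have key : ∀ {a b : E}, W.Dep b a → ∀ c ∈ W.carrier, ∀ d ∈ W.carrier,
      W.rank c < W.rank d → A.le a c → A.le d b → False := by
    intro a b h c hc d hd hlt hac hdb
    have hdc : W.Dep d c := Dep.trans (.inl hdb) (h.trans (.inl hac))
    exact absurd (hdc.rank_le hc) (not_le.2 hlt)
  rcases h with h | ⟨c, hc, d, hd, -, -, hlt, h₁, h₂⟩
  · rcases h' with h' | ⟨c, hc, d, hd, -, -, hlt, h₁, h₂⟩
    · exact A.le_antisymm _ _ h h'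
    · exact (key (.inl h) c hc d hd hlt h₁ h₂).elim
  · exact (key h' c hc d hd hlt h₁ h₂).elim

theorem mem_moves_of_dep {a b : E} (h : W.Dep a b) (hb : b ∈ W.moves) : a ∈ W.moves := by
  refine ⟨fun c hca hc => ?_, A.con_subset _ _ hb.2 fun c hc => Dep.trans hc h⟩
  rcases h with h | ⟨d, hd, -, -, -, -, -, had, -⟩
  · exact hb.1 c (A.le_trans _ _ _ hca h) hc
  · exact W.mem_config.2 _ _ (A.le_trans _ _ _ hca had) hd

theorem mem_moves_of_mem {a : E} (ha : a ∈ W.carrier) : a ∈ W.moves := by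
  refine ⟨fun c hca _ => W.mem_config.2 _ _ hca ha, W.mem_config.1 _ (fun b hb => hb.mem ha) ?_⟩
  refine Set.Finite.of_finite_image ((Set.finite_Iic (W.rank a)).subset ?_) (f := W.rank)
    (W.injOn.mono fun b hb => hb.mem ha)
  rintro _ ⟨b, hb, rfl⟩
  exact hb.rank_le ha

variable (W)

/-- The events of the test: the moves of the game, a neutral event for each Player move of the trace,
and an occurrence of the success move for each Player move of the game. -/
abbrev TestEvent : Type u :=
  W.moves ⊕ {p // p ∈ W.carrier ∧ A.pol p = .pos} ⊕ {q // q ∈ W.moves ∧ A.pol q = .pos}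

variable {W}

/-- The moves on which an event of the test depends: a move depends on itself, the neutral event of `p`
on `p`, and the success event of `q` on `q`, unless `q` belongs to the trace. -/
def support : W.TestEvent → Set E
  | .inl a => {a.1}
  | .inr (.inl p) => {p.1}
  | .inr (.inr q) => {q.1} \ W.carrier

theorem mem_moves_of_mem_support {t : W.TestEvent} {b : E} (hb : b ∈ support t) : b ∈ W.moves := by
  rcases t with a | p | q
  · rw [show b = a.1 from hb]
    exact a.2
  · rw [show b = p.1 from hb]
    exact mem_moves_of_mem p.2.1
  · rw [show b = q.1 from hb.1]
    exact q.2.1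

/-- The moves on which some event of `X` depends. -/
def below (X : Set W.TestEvent) : Set E :=
  {a | ∃ t ∈ X, ∃ b ∈ support t, W.Dep a b}

theorem below_singleton_mem_con (t : W.TestEvent) : below {t} ∈ A.Con := by
  by_cases h : ∃ b, b ∈ support t
  · obtain ⟨b, hb⟩ := h
    refine A.con_subset _ _ (mem_moves_of_mem_support hb).2 ?_
    rintro a ⟨t', ht', b', hb', h⟩
    obtain rfl : t' = t := ht'
    have hbb : b' = b := by
      rcases t' with t | t | t
      · exact hb'.trans hb.symm
      · exact hb'.trans hb.symm
      · exact hb'.1.trans hb.1.symm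
    exact hbb ▸ h
  · obtain ⟨X, hX⟩ := A.con_nonempty
    refine A.con_subset _ _ hX ?_
    rintro a ⟨_, rfl, b, hb, -⟩
    exact (h ⟨b, hb⟩).elim

variable (W)

/-- The event structure of the test. Success events conflict with each other, and the success event of
a Player move of the trace conflicts with its neutral event. -/
def testES : PolarES W.TestEvent where
  le t t' := t = t' ∨ ∃ a : W.moves, t = .inl a ∧ a.1 ∈ below {t'}
  le_refl t := .inl rfl
  le_trans := by
    rintro t₁ t₂ t₃ (rfl | ⟨a, rfl, ha⟩) h
    · exact h
    rcases h with rfl | ⟨b, rfl, _, rfl, c, hc, hbc⟩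
    · exact .inr ⟨a, rfl, ha⟩
    · obtain ⟨_, rfl, _, rfl, hab⟩ := ha
      exact .inr ⟨a, rfl, _, rfl, c, hc, hab.trans hbc⟩
  le_antisymm := by
    rintro t₁ t₂ (rfl | ⟨a, rfl, ha⟩) h
    · rfl
    rcases h with rfl | ⟨b, rfl, hb⟩
    · rfl
    · obtain ⟨_, rfl, _, rfl, hab⟩ := ha
      obtain ⟨_, rfl, _, rfl, hba⟩ := hb
      rw [Subtype.ext (hab.antisymm hba)]
  finite_below t := by
    refine ((((A.finite_of_con _ (below_singleton_mem_con t)).preimage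
      Subtype.val_injective.injOn).image Sum.inl).insert t).subset ?_
    rintro t' (rfl | ⟨a, rfl, ha⟩)
    · exact .inl rfl
    · exact .inr ⟨a, ha, rfl⟩
  Con := {X | X.Finite ∧ below X ∈ A.Con ∧
    (∀ q q', .inr (.inr q) ∈ X → .inr (.inr q') ∈ X → q = q') ∧
    ∀ p q, .inr (.inl p) ∈ X → .inr (.inr q) ∈ X → p.1 ≠ q.1}
  con_nonempty := by
    obtain ⟨X, hX⟩ := A.con_nonempty
    refine ⟨∅, Set.finite_empty, A.con_subset _ _ hX ?_, fun _ _ h => h.elim, fun _ _ h => h.elim⟩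
    rintro a ⟨t, ht, -⟩
    exact ht.elim
  finite_of_con _ h := h.1
  con_singleton t := by
    refine ⟨Set.finite_singleton t, below_singleton_mem_con t, ?_, ?_⟩
    · rintro q q' rfl h
      cases h
      rfl
    · rintro p q rfl h
      cases h
  con_subset X Y hX hYX := by
    refine ⟨hX.1.subset hYX, A.con_subset _ _ hX.2.1 ?_,
      fun q q' h h' => hX.2.2.1 q q' (hYX h) (hYX h'),
      fun p q h h' => hX.2.2.2 p q (hYX h) (hYX h')⟩
    rintro a ⟨t, ht, h⟩
    exact ⟨t, hYX ht, h⟩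
  con_insert := by
    rintro X e e' hX he' (rfl | ⟨a, rfl, ha⟩)
    · rwa [Set.insert_eq_of_mem he']
    obtain ⟨_, rfl, b, hb, hab⟩ := ha
    refine ⟨hX.1.insert _, A.con_subset _ _ hX.2.1 ?_, ?_, ?_⟩
    · rintro c ⟨t, rfl | ht, d, hd, hcd⟩
      · obtain rfl : d = a.1 := hd
        exact ⟨_, he', b, hb, hcd.trans hab⟩
      · exact ⟨t, ht, d, hd, hcd⟩
    · rintro q q' (h | h) (h' | h')
      · cases h
      · cases h
      · cases h'
      · exact hX.2.2.1 q q' h h'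
    · rintro p q (h | h) (h' | h')
      · cases h
      · cases h
      · cases h'
      · exact hX.2.2.2 p q h h'
  pol
    | .inl a => (A.pol a).dual
    | .inr (.inl _) => .zero
    | .inr (.inr _) => .pos

/-- The neutral events, one for each Player move of the trace, independent of each other. -/
def neutralES : PolarES {p // p ∈ W.carrier ∧ A.pol p = .pos} where
  le p q := p = q
  le_refl _ := rfl
  le_trans _ _ _ := Eq.trans
  le_antisymm _ _ h _ := h
  finite_below p := Set.finite_singleton p
  Con := {X | X.Finite}
  con_nonempty := ⟨∅, Set.finite_empty⟩
  finite_of_con _ h := h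
  con_singleton p := Set.finite_singleton p
  con_subset _ _ h h' := h.subset h'
  con_insert _ e _ h _ _ := h.insert e
  pol _ := .zero

/-- The map of the test, on events. -/
def testMap : W.TestEvent → E ⊕ {p // p ∈ W.carrier ∧ A.pol p = .pos} ⊕ PUnit.{u + 1} :=
  Sum.map Subtype.val (Sum.map id fun _ => PUnit.unit)

variable {W}

/-- The moves of the game in a set of events of the test. -/
def movesOf (z : Set W.TestEvent) : Set E :=
  {a | .inl a ∈ W.testMap '' z}

theorem mem_movesOf {z : Set W.TestEvent} {a : E} :
    a ∈ movesOf z ↔ ∃ h : a ∈ W.moves, .inl ⟨a, h⟩ ∈ z := by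
  constructor
  · rintro ⟨b | b | b, hb, h⟩
    · obtain rfl : b.1 = a := Sum.inl_injective h
      exact ⟨b.2, hb⟩
    · cases h
    · cases h
  · rintro ⟨h, hz⟩
    exact ⟨_, hz, rfl⟩

theorem below_subset_movesOf {z : Set W.TestEvent} (hz : z ∈ W.testES.Config) :
    below z ⊆ movesOf z := by
  rintro a ⟨t, ht, b, hb, hab⟩
  have ha : a ∈ W.moves := mem_moves_of_dep hab (mem_moves_of_mem_support hb)
  exact mem_movesOf.2 ⟨ha, hz.2 _ _ (.inr ⟨⟨a, ha⟩, rfl, t, rfl, b, hb, hab⟩) ht⟩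

theorem mem_movesOf_of_dep {z : Set W.TestEvent} (hz : z ∈ W.testES.Config) {a b : E}
    (hb : b ∈ movesOf z) (h : W.Dep a b) : a ∈ movesOf z := by
  obtain ⟨hb, hz'⟩ := mem_movesOf.1 hb
  exact below_subset_movesOf hz ⟨_, hz', b, rfl, h⟩

theorem movesOf_mem_config {z : Set W.TestEvent} (hz : z ∈ W.testES.Config) :
    movesOf z ∈ A.Config := by
  refine ⟨fun X hX hf => ?_, fun a b hba ha => mem_movesOf_of_dep hz ha (.inl hba)⟩
  have hf' : (Sum.inl '' (Subtype.val ⁻¹' X) : Set W.TestEvent).Finite :=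
    (hf.preimage Subtype.val_injective.injOn).image _
  refine A.con_subset _ _ (hz.1 _ ?_ hf').2.1 ?_
  · rintro _ ⟨a, ha, rfl⟩
    exact (mem_movesOf.1 (hX ha)).2
  · intro a ha
    obtain ⟨h, -⟩ := mem_movesOf.1 (hX ha)
    exact ⟨_, ⟨⟨a, h⟩, ha, rfl⟩, a, rfl, Dep.refl a⟩

theorem mem_testES_config {z : Set W.TestEvent} (hA : movesOf z ∈ A.Config)
    (hb : below z ⊆ movesOf z)
    (hq : ∀ q q', .inr (.inr q) ∈ z → .inr (.inr q') ∈ z → q = q')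
    (hpq : ∀ p q, .inr (.inl p) ∈ z → .inr (.inr q) ∈ z → p.1 ≠ q.1) :
    z ∈ W.testES.Config := by
  refine ⟨fun X hX hf => ⟨hf, hA.1 _ ?_ ?_, fun q q' h h' => hq q q' (hX h) (hX h'),
    fun p q h h' => hpq p q (hX h) (hX h')⟩, ?_⟩
  · rintro a ⟨t, ht, h⟩
    exact hb ⟨t, hX ht, h⟩
  · refine (hf.biUnion fun t _ => A.finite_of_con _ (below_singleton_mem_con t)).subset ?_
    rintro a ⟨t, ht, h⟩
    simp only [Set.mem_iUnion]
    exact ⟨t, ht, t, rfl, h⟩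
  · rintro t t' (rfl | ⟨a, rfl, _, rfl, h⟩) ht
    · exact ht
    · exact (mem_movesOf.1 (hb ⟨_, ht, h⟩)).2

theorem success_unique {z : Set W.TestEvent} (hz : z ∈ W.testES.Config)
    {q q' : {q // q ∈ W.moves ∧ A.pol q = .pos}} (h : .inr (.inr q) ∈ z)
    (h' : .inr (.inr q') ∈ z) : q = q' :=
  (hz.1 {.inr (.inr q), .inr (.inr q')} (Set.insert_subset h (Set.singleton_subset_iff.2 h'))
    (Set.toFinite _)).2.2.1 q q' (.inl rfl) (.inr rfl)

theorem neutral_ne_success {z : Set W.TestEvent} (hz : z ∈ W.testES.Config)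
    {p : {p // p ∈ W.carrier ∧ A.pol p = .pos}} {q : {q // q ∈ W.moves ∧ A.pol q = .pos}}
    (h : .inr (.inl p) ∈ z) (h' : .inr (.inr q) ∈ z) : p.1 ≠ q.1 :=
  (hz.1 {.inr (.inl p), .inr (.inr q)} (Set.insert_subset h (Set.singleton_subset_iff.2 h'))
    (Set.toFinite _)).2.2.2 p q (.inl rfl) (.inr rfl)

theorem testMap_injOn {z : Set W.TestEvent} (hz : z ∈ W.testES.Config) :
    Set.InjOn W.testMap z := by
  rintro (a | p | q) h (a' | p' | q') h' e
  · rw [Subtype.ext (Sum.inl_injective e)]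
  · cases e
  · cases e
  · cases e
  · cases e
    rfl
  · cases e
  · cases e
  · cases e
  · rw [success_unique hz h h']

theorem testMap_isTotalMap :
    W.testES.IsTotalMap (A.dual.par (W.neutralES.par PolarES.playerMove)).toEventStructure
      W.testMap := by
  refine fun z hz => ⟨⟨fun X hX hf => ⟨hf, (movesOf_mem_config hz).1 _ (fun a ha => hX ha)
    (hf.preimage Sum.inl_injective.injOn), hf.preimage Sum.inr_injective.injOn,
    (hf.preimage Sum.inr_injective.injOn).preimage Sum.inl_injective.injOn, trivial⟩, ?_⟩,
    testMap_injOn hz⟩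
  rintro _ _ (⟨h⟩ | ⟨h⟩) he
  · exact (movesOf_mem_config hz).2 _ _ h he
  · rcases h with ⟨h⟩ | ⟨h⟩
    · cases h
      exact he
    · exact he

/-- Innocence of the test: the dependencies it adds to those of the game lead from Player moves to
Opponent moves of the game, whose polarities are reversed in the test. -/
theorem testMap_covers {t t' : W.TestEvent} (h : W.testES.Covers t t')
    (hp : W.testES.pol t = .pos ∨ W.testES.pol t' = .neg) :
    (A.dual.par (W.neutralES.par PolarES.playerMove)).Covers (W.testMap t) (W.testMap t') := by
  obtain ⟨hne, hle, hbtw⟩ := h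
  rcases hle with rfl | ⟨a, rfl, t'', ht, b, hb, hab⟩
  · exact (hne rfl).elim
  obtain rfl : t'' = t' := ht
  have hbm := mem_moves_of_mem_support hb
  have hbtw' : ∀ d (hd : W.Dep d b), W.Dep a d →
      d = a.1 ∨ .inl ⟨d, mem_moves_of_dep hd hbm⟩ = t'' := by
    intro d hd had
    rcases hbtw (.inl ⟨d, mem_moves_of_dep hd hbm⟩) (.inr ⟨a, rfl, _, rfl, d, rfl, had⟩)
      (.inr ⟨_, rfl, _, rfl, b, hb, hd⟩) with h | h
    · exact .inl (congrArg Subtype.val (Sum.inl_injective h))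
    · exact .inr h
  have hpol : A.pol a = .neg ∨ W.testES.pol t'' = .neg := by
    refine hp.imp_left fun h => ?_
    change (A.pol a).dual = .pos at h
    cases ha : A.pol a <;> simp_all [Polarity.dual]
  obtain rfl : .inl ⟨b, hbm⟩ = t'' := by
    rcases hbtw' b (Dep.refl b) hab with rfl | h
    · rcases t'' with b | p | q
      · exact (hne (congrArg Sum.inl (Subtype.ext hb))).elim
      · have : A.pol a = .pos := by rw [show a.1 = p.1 from hb, p.2.2]
        rcases hpol with h | h
        · simp [this] at h
        · cases h
      · have : A.pol a = .pos := by rw [show a.1 = q.1 from hb.1, q.2.2]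
        rcases hpol with h | h
        · simp [this] at h
        · cases h
    · exact h
  have hpol' : A.pol a = .neg ∨ A.pol b = .pos := by
    refine hpol.imp_right fun h => ?_
    change (A.pol b).dual = .neg at h
    cases hb : A.pol b <;> simp_all [Polarity.dual]
  have hbtwA : ∀ d, W.Dep a d → W.Dep d b → d = a.1 ∨ d = b := fun d had hdb =>
    (hbtw' d hdb had).imp_right fun h => congrArg Subtype.val (Sum.inl_injective h)
  have hab' : a.1 ≠ b := fun h => hne (congrArg Sum.inl (Subtype.ext h))
  rcases hab with hab | ⟨c, hc, d, hd, hcp, hdn, hlt, hac, hdb⟩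
  · refine ⟨fun h => hab' (Sum.inl_injective h), .inl hab, ?_⟩
    rintro _ (⟨had⟩ | _) (⟨hdb⟩ | _)
    exact (hbtwA _ (.inl had) (.inl hdb)).imp (congrArg Sum.inl) (congrArg Sum.inl)
  -- A dependency through the trace factors through a Player move `c` and an Opponent move `d` of
  -- the trace; an immediate one would have `a = c` and `b = d`, which the polarities exclude.
  · have hcd : W.Dep c d := .of_rank_lt hc hd hcp hdn hlt
    have hcb : W.Dep c b := hcd.trans (.inl hdb)
    have had : W.Dep a d := Dep.trans (.inl hac) hcd
    rcases hpol' with h | h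
    · rcases hbtwA c (.inl hac) hcb with rfl | rfl
      · simp [hcp] at h
      · exact absurd (W.mono _ _ hdb hc) (not_le.2 hlt)
    · rcases hbtwA d had (.inl hdb) with rfl | rfl
      · exact absurd (W.mono _ _ hac hc) (not_le.2 hlt)
      · simp [hdn] at h

/-- Moves received by the test are Player moves of the game. The Opponent moves they depend on have
been played already, together with the Player moves that the test requires before these. -/
theorem testMap_receptive : ∀ x ∈ W.testES.FinConfig,
    ∀ y ∈ (A.dual.par (W.neutralES.par PolarES.playerMove)).FinConfig,
    (A.dual.par (W.neutralES.par PolarES.playerMove)).NegSubset (W.testMap '' x) y →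
    ∃! x', x' ∈ W.testES.FinConfig ∧ x ⊆ x' ∧ W.testMap '' x' = y := by
  rintro x ⟨hx, hxf⟩ y ⟨hy, hyf⟩ ⟨hxy, hneg⟩
  have hyA : {a | Sum.inl a ∈ y} ∈ A.Config :=
    ⟨fun X hX hf => A.con_subset _ _ (hy.1 (Sum.inl '' X) (by rintro _ ⟨a, ha, rfl⟩; exact hX ha)
      (hf.image _)).2.1 fun a ha => ⟨a, ha, rfl⟩, fun a b h ha => hy.2 _ _ (.inl h) ha⟩
  have hold : ∀ e ∈ y, (∀ a, e = .inl a → A.pol a ≠ .pos) → e ∈ W.testMap '' x := by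
    intro e he h
    by_contra hex
    have hn := hneg e ⟨he, hex⟩
    rcases e with a | p | q
    · change (A.pol a).dual = .neg at hn
      refine h a rfl ?_
      cases ha : A.pol a <;> simp [ha, Polarity.dual] at hn ⊢
    · cases hn
    · cases hn
  have hdep : ∀ a b, Sum.inl a ∈ y → W.Dep b a → Sum.inl b ∈ y := by
    rintro a b ha (h | ⟨c, hc, d, hd, hcp, hdn, hlt, hbc, hda⟩)
    · exact hyA.2 _ _ h ha
    · have hdx : d ∈ movesOf x :=
        hold _ (hyA.2 _ _ hda ha) (by rintro _ ⟨⟩; simp [hdn])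
      exact hxy (mem_movesOf_of_dep hx hdx (.trans (.inl hbc) (.of_rank_lt hc hd hcp hdn hlt)))
  have hmoves : ∀ a, Sum.inl a ∈ y → a ∈ W.moves := by
    refine fun a ha => ⟨fun c hca hc => ?_, hyA.1 _ (fun b hb => hdep a b ha hb)
      ((hyf.preimage Sum.inl_injective.injOn).subset fun b hb => hdep a b ha hb)⟩
    have hcx : c ∈ movesOf x := hold _ (hyA.2 _ _ hca ha) (by rintro _ ⟨⟩; simp [hc])
    exact (mem_movesOf.1 hcx).1.1 c (A.le_refl c) hc
  let x' : Set W.TestEvent := x ∪ {t | ∃ a, t = .inl a ∧ Sum.inl a.1 ∈ y}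
  have himg : W.testMap '' x' = y := by
    ext e
    constructor
    · rintro ⟨t, ht | ⟨a, rfl, ha⟩, rfl⟩
      · exact hxy ⟨t, ht, rfl⟩
      · exact ha
    · intro he
      by_cases h : e ∈ W.testMap '' x
      · obtain ⟨t, ht, rfl⟩ := h
        exact ⟨t, .inl ht, rfl⟩
      · rcases e with a | e
        · exact ⟨.inl ⟨a, hmoves a he⟩, .inr ⟨_, rfl, he⟩, rfl⟩
        · exact (h (hold _ he (by rintro _ ⟨⟩))).elim
  have hmem : movesOf x' = {a | Sum.inl a ∈ y} := by
    ext a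
    change Sum.inl a ∈ W.testMap '' x' ↔ _
    rw [himg]
    rfl
  have hx' : x' ∈ W.testES.Config := by
    refine mem_testES_config (hmem ▸ hyA) ?_ ?_ ?_
    · rintro a ⟨t, ht | ⟨c, rfl, hc⟩, b, hb, hab⟩
      · rw [hmem]
        exact hxy (below_subset_movesOf hx ⟨t, ht, b, hb, hab⟩)
      · rw [hmem]
        obtain rfl : b = c.1 := hb
        exact hdep _ _ hc hab
    · rintro q q' (h | ⟨_, h, -⟩) (h' | ⟨_, h', -⟩)
      · exact success_unique hx h h'
      · cases h'
      · cases h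
      · cases h
    · rintro p q (h | ⟨_, h, -⟩) (h' | ⟨_, h', -⟩)
      · exact neutral_ne_success hx h h'
      · cases h'
      · cases h
      · cases h
  refine ⟨x', ⟨⟨hx', ?_⟩, Set.subset_union_left, himg⟩, ?_⟩
  · exact Set.Finite.of_finite_image (himg ▸ hyf) (testMap_injOn hx')
  · rintro x'' ⟨⟨hx'', -⟩, hsub, himg''⟩
    ext t
    constructor
    · intro ht
      have hty : W.testMap t ∈ y := himg'' ▸ ⟨t, ht, rfl⟩
      by_cases h : W.testMap t ∈ W.testMap '' x
      · obtain ⟨t', ht', htt⟩ := h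
        exact .inl (testMap_injOn hx'' (hsub ht') ht htt ▸ ht')
      · rcases t with a | t
        · exact .inr ⟨a, rfl, hty⟩
        · exact (h (hold _ hty (by rintro _ ⟨⟩))).elim
    · rintro (ht | ⟨a, rfl, ha⟩)
      · exact hsub ht
      · have : a.1 ∈ movesOf x'' := by
          change _ ∈ W.testMap '' x''
          rwa [himg'']
        exact (mem_movesOf.1 this).2

variable (W)

/-- The test for a trace. A run of it can only stop without success when exactly the moves of the
trace have been played. -/
def test : Test A where
  NEvent := {p // p ∈ W.carrier ∧ A.pol p = .pos}
  N := W.neutralES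
  neutral _ := rfl
  Event := W.TestEvent
  S := W.testES
  map := W.testMap
  isStrategyMap :=
    { total_map := testMap_isTotalMap
      pol_eq := by
        rintro (a | p | q) <;> rfl
      receptive := testMap_receptive
      pos_innocent := fun _ _ h hp => testMap_covers h (.inl hp)
      neg_innocent := fun _ _ h hp => testMap_covers h (.inr hp) }

variable {W}

/-- The run that plays the trace and all neutral events. -/
theorem exists_posMaximal_not_success (hgame : A.IsGame) :
    ∃ z, W.testES.PosMaximal z ∧ movesOf z = W.carrier ∧ ∀ q, .inr (.inr q) ∉ z := by
  let z : Set W.TestEvent := {t | (∃ a, t = .inl a ∧ a.1 ∈ W.carrier) ∨ ∃ p, t = .inr (.inl p)}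
  have hm : movesOf z = W.carrier := by
    ext a
    rw [mem_movesOf]
    constructor
    · rintro ⟨h, ⟨_, ⟨⟩, ha⟩ | ⟨_, ⟨⟩⟩⟩
      exact ha
    · exact fun ha => ⟨mem_moves_of_mem ha, .inl ⟨_, rfl, ha⟩⟩
  have hq : ∀ q, .inr (.inr q) ∉ z := by
    rintro q (⟨_, ⟨⟩, _⟩ | ⟨_, ⟨⟩⟩)
  refine ⟨z, ⟨mem_testES_config (hm ▸ W.mem_config) ?_ (fun q _ h => (hq q h).elim)
    fun _ q _ h => (hq q h).elim, ?_⟩, hm, hq⟩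
  · rw [hm]
    rintro a ⟨_, ⟨b, rfl, hb⟩ | ⟨p, rfl⟩, c, hc, hac⟩
    · obtain rfl : c = b.1 := hc
      exact hac.mem hb
    · obtain rfl : c = p.1 := hc
      exact hac.mem p.2.1
  · rintro z' hz' ⟨hzz', hpos⟩
    refine (Set.Subset.antisymm hzz' ?_).symm
    intro t ht
    by_contra htz
    have hpol := hpos t ⟨ht, htz⟩
    rcases t with a | p | q
    · -- A move added by the test itself is an Opponent move, so it belongs to the trace.
      refine htz (.inl ⟨a, rfl, a.2.1 _ (A.le_refl _) ?_⟩)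
      change (A.pol a).dual = .pos ∨ (A.pol a).dual = .zero at hpol
      cases ha : A.pol a
      · simp [ha, Polarity.dual] at hpol
      · rfl
      · exact (hgame a ha).elim
    · exact htz (.inr ⟨p, rfl⟩)
    · by_cases hqc : q.1 ∈ W.carrier
      · have hp : Sum.inr (Sum.inl ⟨q.1, hqc, q.2.2⟩) ∈ z' := hzz' (.inr ⟨_, rfl⟩)
        exact neutral_ne_success hz' hp ht rfl
      · have hqz : q.1 ∈ movesOf z' :=
          below_subset_movesOf hz' ⟨_, ht, q.1, ⟨rfl, hqc⟩, Dep.refl _⟩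
        obtain ⟨hq', hqz⟩ := mem_movesOf.1 hqz
        have hqz' : .inl ⟨q.1, hq'⟩ ∉ z := by
          rintro (⟨_, ⟨⟩, h⟩ | ⟨_, ⟨⟩⟩)
          exact hqc h
        have := hpos _ ⟨hqz, hqz'⟩
        change (A.pol q.1).dual = .pos ∨ (A.pol q.1).dual = .zero at this
        rw [q.2.2] at this
        simp [Polarity.dual] at this

/-- In a +-maximal run without success, no success event is enabled. -/
theorem not_enabled_of_posMaximal {z : Set W.TestEvent} (hz : W.testES.PosMaximal z)
    (hs : ∀ q, .inr (.inr q) ∉ z) (q : {q // q ∈ W.moves ∧ A.pol q = .pos})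
    (hq : q.1 ∈ W.carrier ∨ q.1 ∈ movesOf z) : ∃ p, .inr (.inl p) ∈ z ∧ p.1 = q.1 := by
  by_contra! hp
  have hm : movesOf (insert (.inr (.inr q)) z) = movesOf z := by
    ext a
    simp [mem_movesOf]
  have hconf : insert (.inr (.inr q)) z ∈ W.testES.Config := by
    refine mem_testES_config (hm ▸ movesOf_mem_config hz.1) ?_ ?_ ?_
    · rw [hm]
      rintro a ⟨t, rfl | ht, b, hb, hab⟩
      · obtain ⟨rfl, hbc⟩ := hb
        exact mem_movesOf_of_dep hz.1 (hq.resolve_left hbc) hab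
      · exact below_subset_movesOf hz.1 ⟨t, ht, b, hb, hab⟩
    · rintro q₁ q₂ (⟨⟨⟩⟩ | h) (⟨⟨⟩⟩ | h')
      · rfl
      · exact (hs _ h').elim
      · exact (hs _ h).elim
      · exact (hs _ h).elim
    · rintro p q' (h | h) (h' | h')
      · cases h
      · cases h
      · cases h'
        exact hp p h
      · exact (hs _ h').elim
  have := hz.2 _ hconf ⟨Set.subset_insert _ _, by
    rintro t ⟨rfl | ht, hn⟩
    · exact .inl rfl
    · exact (hn ht).elim⟩
  exact hs q (this ▸ Set.mem_insert _ _)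

/-- A run that stops without success has played exactly the moves of the trace. -/
theorem movesOf_eq_of_posMaximal (hgame : A.IsGame) {z : Set W.TestEvent}
    (hz : W.testES.PosMaximal z) (hs : ∀ q, .inr (.inr q) ∉ z) : movesOf z = W.carrier := by
  have hsub : movesOf z ⊆ W.carrier := by
    intro a ha
    by_contra haW
    have hm := (mem_movesOf.1 ha).1
    have hpos : A.pol a = .pos := by
      cases h : A.pol a
      · rfl
      · exact (haW (hm.1 a (A.le_refl a) h)).elim
      · exact (hgame a h).elim
    obtain ⟨p, -, hp⟩ := not_enabled_of_posMaximal hz hs ⟨a, hm, hpos⟩ (.inr ha)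
    exact haW ((show p.1 = a from hp) ▸ p.2.1)
  refine hsub.antisymm fun a ha => ?_
  -- All dependencies of a move of the trace have smaller rank, so by induction on the rank the test
  -- can play an Opponent move that is missing, against +-maximality.
  induction hn : W.rank a using Nat.strong_induction_on generalizing a with
  | _ n ih =>
  have hm := mem_moves_of_mem ha
  cases hpol : A.pol a with
  | pos =>
    obtain ⟨p, hpz, hp⟩ := not_enabled_of_posMaximal hz hs ⟨a, hm, hpol⟩ (.inl ha)
    exact below_subset_movesOf hz.1 ⟨_, hpz, _, rfl, by rw [hp]; exact Dep.refl a⟩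
  | zero => exact (hgame a hpol).elim
  | neg =>
    have hins : movesOf (insert (.inl ⟨a, hm⟩) z) = insert a (movesOf z) := by
      ext b
      simp only [mem_movesOf, Set.mem_insert_iff, Sum.inl.injEq, Subtype.mk.injEq]
      constructor
      · rintro ⟨h, h' | h'⟩
        · exact .inl h'
        · exact .inr ⟨h, h'⟩
      · rintro (rfl | ⟨h, h'⟩)
        · exact ⟨hm, .inl rfl⟩
        · exact ⟨h, .inr h'⟩
    have hdep : ∀ b, W.Dep b a → b ∈ insert a (movesOf z) := by
      intro b hb
      have hbW := hb.mem ha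
      rcases (hb.rank_le ha).lt_or_eq with hlt | heq
      · exact .inr (ih _ (hn ▸ hlt) b hbW rfl)
      · exact .inl (W.injOn hbW ha heq)
    have hconf : insert (.inl ⟨a, hm⟩) z ∈ W.testES.Config := by
      refine mem_testES_config ?_ ?_ ?_ ?_
      · rw [hins]
        refine EventStructure.mem_config_of_subset W.mem_config
          (Set.insert_subset ha hsub) ?_
        rintro e e' hle (rfl | he)
        · exact hdep _ (.inl hle)
        · exact .inr (mem_movesOf_of_dep hz.1 he (.inl hle))
      · rw [hins]
        rintro b ⟨t, rfl | ht, c, hc, hbc⟩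
        · obtain rfl : c = a := hc
          exact hdep _ hbc
        · exact .inr (below_subset_movesOf hz.1 ⟨t, ht, c, hc, hbc⟩)
      · rintro q _ (⟨⟨⟩⟩ | h) _
        exact (hs _ h).elim
      · rintro _ q _ (⟨⟨⟩⟩ | h)
        exact (hs _ h).elim
    have := hz.2 _ hconf ⟨Set.subset_insert _ _, by
      rintro t ⟨rfl | ht, hnt⟩
      · left
        change (A.pol a).dual = .pos
        rw [hpol]
        rfl
      · exact (hnt ht).elim⟩
    rw [this] at hins
    rw [hins]
    exact .inl rfl

end RankedConfig

/-! ### Traces -/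

namespace StoppingStrategy

variable {E : Type u} {A : PolarES E} (σ : StoppingStrategy A)

variable {σ} in
theorem IsTrace.mem_image_iff {α : Stream'.Seq E} {x : Set σ.Event} (h : σ.IsTrace α x) (a : E) :
    a ∈ σ.map '' x ↔ ∃ i, α.get? i = some a := by
  obtain ⟨s, hs, rfl⟩ := h
  simp only [Stream'.Seq.map_get?, Option.map_eq_some_iff]
  conv_lhs => rw [hs.range_eq]
  constructor
  · rintro ⟨e, ⟨i, hi⟩, rfl⟩
    exact ⟨i, e, hi, rfl⟩
  · rintro ⟨i, e, hi, rfl⟩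
    exact ⟨e, ⟨i, hi⟩, rfl⟩

variable {σ} in
/-- A trace is a ranked configuration of the game. -/
theorem IsTrace.exists_rankedConfig {α : Stream'.Seq E} {x : Set σ.Event} (h : σ.IsTrace α x) :
    ∃ W : RankedConfig A, W.carrier = σ.map '' x ∧
      (∀ i a, α.get? i = some a ↔ a ∈ W.carrier ∧ W.rank a = i) ∧
      ∀ e ∈ x, ∀ e' ∈ x, σ.S.le e e' → W.rank (σ.map e) ≤ W.rank (σ.map e') := by
  classical
  obtain ⟨s, hs, rfl⟩ := h
  obtain ⟨k, hk, hconf⟩ := hs.exists_index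
  have hinj := (σ.isStrategyMap.total_map x hs.mem_config).2
  let r : E → ℕ := fun a => if h : ∃ e ∈ x, σ.map e = a then k h.choose else 0
  have hr : ∀ e ∈ x, r (σ.map e) = k e := by
    intro e he
    have h : ∃ e' ∈ x, σ.map e' = σ.map e := ⟨e, he, rfl⟩
    simp only [r, dif_pos h]
    rw [hinj h.choose_spec.1 he h.choose_spec.2]
  refine ⟨⟨σ.map '' x, r, (σ.isStrategyMap.total_map x hs.mem_config).1, ?_, ?_⟩, rfl, ?_, ?_⟩
  · rintro _ ⟨e, he, rfl⟩ _ ⟨e', he', rfl⟩ h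
    rw [hr e he, hr e' he'] at h
    have h₁ := (hk _ _).2 ⟨he, h⟩
    rw [(hk _ _).2 ⟨he', rfl⟩] at h₁
    rw [Option.some_injective _ h₁]
  · rintro a _ hle ⟨e, he, rfl⟩
    obtain ⟨e', ⟨he', hle'⟩, rfl⟩ :=
      (σ.isStrategyMap.total_map _ (hconf (k e))).1.2 _ _ hle ⟨e, ⟨he, le_rfl⟩, rfl⟩
    rw [hr e he, hr e' he']
    exact hle'
  · intro i a
    simp only [Stream'.Seq.map_get?, Option.map_eq_some_iff, hk]
    constructor
    · rintro ⟨e, ⟨he, rfl⟩, rfl⟩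
      exact ⟨⟨e, he, rfl⟩, hr e he⟩
    · rintro ⟨⟨e, he, rfl⟩, rfl⟩
      exact ⟨e, ⟨he, (hr e he).symm⟩, rfl⟩
  · intro e he e' he' hle
    simp only [hr e he, hr e' he']
    exact ((hconf (k e')).2 _ _ hle ⟨he', le_rfl⟩).2

/-- A ranking of the image that respects causal dependency in the strategy is a trace. -/
theorem isTrace_of_rank {W : RankedConfig A} {α : Stream'.Seq E} {x : Set σ.Event}
    (hx : x ∈ σ.S.Config) (hW : W.carrier = σ.map '' x)
    (hα : ∀ i a, α.get? i = some a ↔ a ∈ W.carrier ∧ W.rank a = i)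
    (hmono : ∀ e e', σ.S.le e e' → e' ∈ x → W.rank (σ.map e) ≤ W.rank (σ.map e')) :
    σ.IsTrace α x := by
  classical
  let f : ℕ → Option σ.Event := fun i =>
    if h : ∃ e ∈ x, W.rank (σ.map e) = i then some h.choose else none
  have hf : ∀ i e, f i = some e ↔ e ∈ x ∧ W.rank (σ.map e) = i := by
    intro i e
    by_cases hi : ∃ e ∈ x, W.rank (σ.map e) = i
    · simp only [f, dif_pos hi, Option.some.injEq]
      have hs := hi.choose_spec
      constructor
      · rintro rfl
        exact hs
      · rintro ⟨he, hei⟩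
        exact (σ.isStrategyMap.total_map x hx).2 hs.1 he
          (W.injOn (hW ▸ ⟨_, hs.1, rfl⟩) (hW ▸ ⟨_, he, rfl⟩) (hs.2.trans hei.symm))
    · simp only [f, dif_neg hi, reduceCtorEq, false_iff]
      exact fun h => hi ⟨e, h⟩
  have hfα : ∀ i, α.get? i = (f i).map σ.map := by
    intro i
    ext a
    rw [hα, hW, Option.map_eq_some_iff]
    constructor
    · rintro ⟨⟨e, he, rfl⟩, hi⟩
      exact ⟨e, (hf _ _).2 ⟨he, hi⟩, rfl⟩
    · rintro ⟨e, he, rfl⟩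
      obtain ⟨he, hi⟩ := (hf _ _).1 he
      exact ⟨⟨e, he, rfl⟩, hi⟩
  have f_seq : Stream'.IsSeq (α := σ.Event) f := by
    intro i hi
    change f i = none at hi
    have h₁ : α.get? i = none := by rw [hfα, hi, Option.map_none]
    have h₂ : α.get? (i + 1) = none := α.2 h₁
    rwa [hfα, Option.map_eq_none_iff] at h₂
  refine ⟨⟨f, f_seq⟩, EventStructure.isSerialisation_of_index hx hf hmono, ?_⟩
  ext1 i
  rw [hfα]
  exact (Stream'.Seq.map_get? σ.map ⟨f, f_seq⟩ i).symm

/-- Trace inclusion transfers defined interactions: a common enumeration of the moves of `x₁` and of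
the test yields a trace of `x₁`, hence one of some `x₂`, which the test respects as well. -/
theorem mustPass_of_forall_isTrace (hcount : A.ConsistentCountable) {σ₁ σ₂ : StoppingStrategy A}
    (h : ∀ x₁ ∈ σ₁.M, ∀ α : Stream'.Seq E, σ₁.IsTrace α x₁ → ∃ x₂ ∈ σ₂.M, σ₂.IsTrace α x₂)
    {τ : Test A} (hτ : σ₂.MustPass τ) : σ₁.MustPass τ := by
  rintro x₁ hx₁ _ ⟨z, hz, rfl⟩ hdef
  have hc₁ := σ₁.M_subset hx₁
  obtain ⟨himg, ρ, hρ, hS, hT⟩ := (interactionDefined_iff hcount σ₁ τ hc₁ hz.1).1 hdef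
  have hinj : Set.InjOn (fun s => ρ (.inl (σ₁.map s))) x₁ := by
    intro s hs s' hs' hss
    refine (σ₁.isStrategyMap.total_map x₁ hc₁).2 hs hs' (Sum.inl_injective (hρ ?_ ?_ hss))
    · exact τ.inl_mem_image_visMap.2 ((himg _).2 ⟨s, hs, rfl⟩)
    · exact τ.inl_mem_image_visMap.2 ((himg _).2 ⟨s', hs', rfl⟩)
  obtain ⟨s, hs, hsρ⟩ := EventStructure.exists_serialisation_of_rank hc₁ hinj hS
  have htr : σ₁.IsTrace (s.map σ₁.map) x₁ := ⟨s, hs, rfl⟩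
  obtain ⟨x₂, hx₂, htr₂⟩ := h x₁ hx₁ _ htr
  have hc₂ := σ₂.M_subset hx₂
  obtain ⟨W, hW, hWα, hWm⟩ := htr₂.exists_rankedConfig
  refine hτ x₂ hx₂ _ ⟨z, hz, rfl⟩ ((interactionDefined_iff hcount σ₂ τ hc₂ hz.1).2
    ⟨fun a => ?_, ρ, hρ, fun e he e' he' hle => ?_, hT⟩)
  · rw [himg, htr.mem_image_iff, htr₂.mem_image_iff]
  · have hmem : ∀ e ∈ x₂, σ₂.map e ∈ W.carrier := fun e he => hW ▸ ⟨e, he, rfl⟩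
    have h₁ := (hWα _ _).2 ⟨hmem e he, rfl⟩
    have h₂ := (hWα _ _).2 ⟨hmem e' he', rfl⟩
    simp only [Stream'.Seq.map_get?, Option.map_eq_some_iff] at h₁ h₂
    obtain ⟨d, hd, hde⟩ := h₁
    obtain ⟨d', hd', hde'⟩ := h₂
    rw [← hde, ← hde']
    exact hsρ _ _ _ _ hd hd' (hWm e he e' he' hle)

end StoppingStrategy

namespace RankedConfig

variable {E : Type u} {A : PolarES E} {W : RankedConfig A}

theorem success_mem_iff {z : Set W.TestEvent} :
    Sum.inr PUnit.unit ∈ W.test.visMap '' (Subtype.val ⁻¹' z) ↔ ∃ q, .inr (.inr q) ∈ z := by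
  refine W.test.inr_mem_image_visMap.trans ?_
  constructor
  · rintro ⟨a | p | q, h, h'⟩
    · cases h'
    · cases h'
    · exact ⟨q, h⟩
  · rintro ⟨q, h⟩
    exact ⟨_, h, rfl⟩

theorem exists_eq_inl_of_visible {z : Set W.TestEvent} (hs : ∀ q, .inr (.inr q) ∉ z)
    (t : W.test.visible) (ht : t.1 ∈ z) :
    ∃ a : W.moves, t.1 = .inl a ∧ W.test.visMap t = .inl a.1 := by
  obtain ⟨a | p | q, hv⟩ := t
  · exact ⟨a, rfl, rfl⟩
  · cases hv
  · exact (hs q ht).elim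

/-- A strategy whose trace is `W` can stop in its test without success. -/
theorem not_mustPass_test (hgame : A.IsGame) (hcount : A.ConsistentCountable)
    {σ : StoppingStrategy A} {x : Set σ.Event} (hx : x ∈ σ.M) (hW : W.carrier = σ.map '' x)
    (hmono : ∀ e ∈ x, ∀ e' ∈ x, σ.S.le e e' → W.rank (σ.map e) ≤ W.rank (σ.map e')) :
    ¬σ.MustPass W.test := by
  intro hpass
  obtain ⟨z, hz, hm, hs⟩ := exists_posMaximal_not_success (W := W) hgame
  refine (success_mem_iff.1 (hpass x hx _ ⟨z, hz, rfl⟩ ?_)).elim hs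
  refine (σ.interactionDefined_iff hcount W.test (σ.M_subset hx) hz.1).2
    ⟨fun a => ?_, Sum.elim W.rank fun _ => 0, ?_, hmono, ?_⟩
  · change a ∈ movesOf z ↔ _
    rw [hm, hW]
  · have key : ∀ t : W.test.visible, t.1 ∈ z → ∃ a ∈ W.carrier, W.test.visMap t = .inl a := by
      intro t ht
      obtain ⟨a, hta, hva⟩ := exists_eq_inl_of_visible hs t ht
      exact ⟨a, hm ▸ mem_movesOf.2 ⟨a.2, hta ▸ ht⟩, hva⟩
    rintro _ ⟨t, ht, rfl⟩ _ ⟨t', ht', rfl⟩ h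
    obtain ⟨a, ha, hta⟩ := key t ht
    obtain ⟨a', ha', hta'⟩ := key t' ht'
    rw [hta, hta'] at h ⊢
    rw [W.injOn ha ha' h]
  · intro t t' ht ht' hle
    obtain ⟨a, hta, hva⟩ := exists_eq_inl_of_visible hs t ht
    obtain ⟨a', hta', hva'⟩ := exists_eq_inl_of_visible hs t' ht'
    have ha' : a'.1 ∈ W.carrier := hm ▸ mem_movesOf.2 ⟨a'.2, hta' ▸ ht'⟩
    rw [hva, hva']
    rw [hta, hta'] at hle
    rcases hle with h | ⟨b, hb, _, rfl, c, hc, hbc⟩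
    · rw [Sum.inl_injective h]
    · obtain rfl : c = a'.1 := hc
      rw [Sum.inl_injective hb]
      exact hbc.rank_le ha'

/-- A strategy that can stop in the test without success has the trace. -/
theorem mustPass_test_of_not_isTrace (hgame : A.IsGame) (hcount : A.ConsistentCountable)
    {σ : StoppingStrategy A} {α : Stream'.Seq E}
    (hα : ∀ i a, α.get? i = some a ↔ a ∈ W.carrier ∧ W.rank a = i)
    (h : ∀ x ∈ σ.M, ¬σ.IsTrace α x) : σ.MustPass W.test := by
  rintro x hx _ ⟨z, hz, rfl⟩ hdef
  by_contra hns
  have hs : ∀ q, .inr (.inr q) ∉ z := fun q hq => hns (success_mem_iff.2 ⟨q, hq⟩)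
  have hc := σ.M_subset hx
  have hm := movesOf_eq_of_posMaximal hgame hz hs
  obtain ⟨himg, ρ, hρ, hS, hT⟩ := (σ.interactionDefined_iff hcount W.test hc hz.1).1 hdef
  have hW : W.carrier = σ.map '' x := by
    rw [← hm]
    exact Set.ext himg
  refine h x hx (σ.isTrace_of_rank hc hW hα fun e e' hle he' => ?_)
  refine σ.S.covers_induction (R := fun e e' => W.rank (σ.map e) ≤ W.rank (σ.map e'))
    (fun _ => le_rfl) (fun _ _ _ => le_trans) hc (fun s s' hs' hcov => ?_) hle he'
  have hsx : s ∈ x := hc.2 _ _ hcov.2.1 hs'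
  have hsW : σ.map s ∈ W.carrier := hW ▸ ⟨s, hsx, rfl⟩
  have hsW' : σ.map s' ∈ W.carrier := hW ▸ ⟨s', hs', rfl⟩
  have hpol := σ.isStrategyMap.pol_eq
  -- A causal link that innocence does not trace back to the game leads from an Opponent move to a
  -- Player move; against the order of the trace, it would close a cycle with the test.
  by_cases hinn : σ.S.pol s = .pos ∨ σ.S.pol s' = .neg
  · have hcov' : A.Covers (σ.map s) (σ.map s') :=
      hinn.elim (σ.isStrategyMap.pos_innocent _ _ hcov) (σ.isStrategyMap.neg_innocent _ _ hcov)
    exact W.mono _ _ hcov'.2.1 hsW'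
  · by_contra! hlt
    push Not at hinn
    have hn : A.pol (σ.map s) = .neg := by
      cases h : A.pol (σ.map s)
      · exact (hinn.1 (by rw [← hpol, h])).elim
      · rfl
      · exact (hgame _ h).elim
    have hp : A.pol (σ.map s') = .pos := by
      cases h : A.pol (σ.map s')
      · rfl
      · exact (hinn.2 (by rw [← hpol, h])).elim
      · exact (hgame _ h).elim
    obtain ⟨hmv, hmz⟩ := mem_movesOf.1 (hm.symm ▸ hsW)
    obtain ⟨hmv', hmz'⟩ := mem_movesOf.1 (hm.symm ▸ hsW')
    have h₁ : ρ (.inl (σ.map s')) ≤ ρ (.inl (σ.map s)) :=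
      hT ⟨.inl ⟨_, hmv'⟩, rfl⟩ ⟨.inl ⟨_, hmv⟩, rfl⟩ hmz' hmz
        (.inr ⟨_, rfl, _, rfl, _, rfl, Dep.of_rank_lt hsW' hsW hp hn hlt⟩)
    have hmem : ∀ s ∈ x, Sum.inl (σ.map s) ∈ W.test.visMap '' (Subtype.val ⁻¹' z) := fun s hs =>
      W.test.inl_mem_image_visMap.2 ((himg _).2 ⟨s, hs, rfl⟩)
    have h₂ := hρ (hmem s hsx) (hmem s' hs') (le_antisymm (hS s hsx s' hs' hcov.2.1) h₁)
    rw [Sum.inl_injective h₂, hp] at hn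
    cases hn

end RankedConfig

theorem mainTheorem1 {E : Type u} (A : PolarES E) (hgame : A.IsGame) (hrace : A.RaceFree)
    (hcount : A.ConsistentCountable) (σ₁ σ₂ : StoppingStrategy A) :
    (∀ τ : Test A, σ₂.MustPass τ → σ₁.MustPass τ) ↔
      ∀ x₁ ∈ σ₁.M, ∀ α : Stream'.Seq E, σ₁.IsTrace α x₁ →
        ∃ x₂ ∈ σ₂.M, σ₂.IsTrace α x₂ := by
  refine ⟨fun h x₁ hx₁ α hα => ?_, fun h τ hτ =>
    StoppingStrategy.mustPass_of_forall_isTrace hcount h hτ⟩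
  by_contra! hno
  obtain ⟨W, hW, hWα, hmono⟩ := hα.exists_rankedConfig
  exact RankedConfig.not_mustPass_test hgame hcount hx₁ hW hmono
    (h _ (RankedConfig.mustPass_test_of_not_isTrace hgame hcount hWα hno))
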